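/- Let $\mathbb{O}$ be the real algebra with basis $e_0=1,e_1,\dots,e_7$ and product determined by $e_0$ being the unit and $e_ie_j=-\delta_{ij}e_0+\sum_k\epsilon_{ijk}e_k$ for $1\le i,j\le 7$, where $\epsilon$ is the completely antisymmetric symbol equal to $1$ for $ijk=123,145,167,246,275,374,365$ and equal to $0$ for index triples that are not permutations of these. Identify $\mathbb{R}^7$, with its standard scalar product $\langle\cdot,\cdot\rangle$, with the imaginary octonions, and put $u\times v=\tfrac12(uv-vu)$ and $\widetilde\omega(u,v,w)=\langle u\times v,w\rangle$ for $u,v,w\in\mathbb{R}^7$. Let $\mathbb{S}^6\subset\mathbb{R}^7$ be the unit sphere, $g$ its round metric (induced by $\langle\cdot,\cdot\rangle$), $\omega=j^*\widetilde\omega$ the pullback of $\widetilde\omega$ under the inclusion $j:\mathbb{S}^6\hookrightarrow\mathbb{R}^7$, and $J$ the almost complex structure $J_p(u)=p\times u$ for $p\in\mathbb{S}^6$ and $u\in T_p\mathbb{S}^6=p^\perp$. Let $N_J$ be its Nijenhuis tensor, $N_J(X,Y)=[JX,JY]-J[JX,Y]-J[X,JY]-[X,Y]$. Then for all smooth vector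 fields $X,Y,Z$ on $\mathbb{S}^6$, $$\omega(X,Y,Z)=-\tfrac14\, g\big(N_J(X,Y),JZ\big)$$ at every point of $\mathbb{S}^6$. -/

import Mathlib

open scoped Manifold ContDiff RealInnerProductSpace

namespace SixSphere

/-- `ℝ⁷` with its standard scalar product. The coordinates `x¹, …, x⁷` are indexed by `0, …, 6`. -/
abbrev E7 : Type := EuclideanSpace ℝ (Fin 7)

/-- The seven oriented triples `123, 145, 167, 246, 275, 374, 365`, with indices shifted by one. -/
def IsTriple (i j k : Fin 7) : Prop :=
  (i, j, k) ∈ ([(0, 1, 2), (0, 3, 4), (0, 5, 6), (1, 3, 5), (1, 6, 4), (2, 6, 3), (2, 5, 4)] :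
    List (Fin 7 × Fin 7 × Fin 7))

instance (i j k : Fin 7) : Decidable (IsTriple i j k) := by
  unfold IsTriple; infer_instance

/-- The completely antisymmetric symbol `ε`, equal to `1` on the seven oriented triples. -/
def eps (i j k : Fin 7) : ℤ :=
  if IsTriple i j k ∨ IsTriple j k i ∨ IsTriple k i j then 1
  else if IsTriple j i k ∨ IsTriple i k j ∨ IsTriple k j i then -1
  else 0

/-- The real vector space of octonions: pairs (real part, imaginary part). -/
abbrev Octonion : Type := ℝ × E7

/-- The octonionic product: the bilinear product for which `e₀ = (1, 0)` is the unit and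
`eᵢ eⱼ = - δᵢⱼ e₀ + ∑ₖ εᵢⱼₖ eₖ` for the standard basis vectors of the imaginary part. -/
noncomputable def octMul (x y : Octonion) : Octonion :=
  (x.1 * y.1 - ∑ i, x.2 i * y.2 i,
    x.1 • y.2 + y.1 • x.2 +
      WithLp.toLp 2 (fun k => ∑ i, ∑ j, (eps i j k : ℝ) * x.2 i * y.2 j))

/-- An element of `ℝ⁷` as an imaginary octonion. -/
def imag (u : E7) : Octonion := (0, u)

/-- The cross product on `ℝ⁷`: half of the octonionic commutator, which is purely imaginary
(see `imag_cross`). -/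
noncomputable def cross (u v : E7) : E7 :=
  ((1 / 2 : ℝ) • (octMul (imag u) (imag v) - octMul (imag v) (imag u))).2

theorem imag_cross (u v : E7) :
    imag (cross u v) =
      (1 / 2 : ℝ) • (octMul (imag u) (imag v) - octMul (imag v) (imag u)) := by
  ext1
  · simp [imag, octMul, mul_comm]
  · rfl

theorem eps_swap_left : ∀ i j k : Fin 7, eps j i k = -eps i j k := by decide

theorem eps_swap_right : ∀ i j k : Fin 7, eps i k j = -eps i j k := by decide

theorem cross_apply (u v : E7) (k : Fin 7) :
    cross u v k = ∑ i, ∑ j, (eps i j k : ℝ) * u i * v j := by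
  have h : ∑ i, ∑ j, (eps i j k : ℝ) * v i * u j = -∑ i, ∑ j, (eps i j k : ℝ) * u i * v j := by
    rw [Finset.sum_comm, ← Finset.sum_neg_distrib]
    refine Finset.sum_congr rfl fun i _ => ?_
    rw [← Finset.sum_neg_distrib]
    refine Finset.sum_congr rfl fun j _ => ?_
    rw [eps_swap_left i j k]
    push_cast
    ring
  simp only [cross, imag, octMul, Prod.snd_sub, Prod.smul_snd, PiLp.smul_apply, PiLp.sub_apply,
    PiLp.add_apply, smul_eq_mul, zero_mul, zero_add, h]
  ring

/-- The cross product as a bilinear map. -/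
noncomputable def crossL : E7 →ₗ[ℝ] E7 →ₗ[ℝ] E7 :=
  LinearMap.mk₂ ℝ cross
    (fun u u' v => by
      ext k
      simp [cross_apply, mul_add, add_mul, Finset.sum_add_distrib])
    (fun c u v => by
      ext k
      simp only [cross_apply, PiLp.smul_apply, smul_eq_mul, Finset.mul_sum]
      exact Finset.sum_congr rfl fun i _ => Finset.sum_congr rfl fun j _ => by ring)
    (fun u v v' => by
      ext k
      simp [cross_apply, mul_add, Finset.sum_add_distrib])
    (fun c u v => by
      ext k
      simp only [cross_apply, PiLp.smul_apply, smul_eq_mul, Finset.mul_sum]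
      exact Finset.sum_congr rfl fun i _ => Finset.sum_congr rfl fun j _ => by ring)

theorem inner_self_cross (u v : E7) : ⟪u, cross u v⟫ = 0 := by
  have h : ⟪u, cross u v⟫ = ∑ j, ∑ i, ∑ k, (eps i j k : ℝ) * u i * v j * u k := by
    simp only [PiLp.inner_apply, cross_apply, RCLike.inner_apply, conj_trivial, Finset.sum_mul]
    rw [Finset.sum_comm, Finset.sum_congr rfl fun i _ => Finset.sum_comm, Finset.sum_comm]
  have h' : ∑ j, ∑ i, ∑ k, (eps i j k : ℝ) * u i * v j * u k =
      -∑ j, ∑ i, ∑ k, (eps i j k : ℝ) * u i * v j * u k := by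
    rw [← Finset.sum_neg_distrib]
    refine Finset.sum_congr rfl fun j _ => ?_
    conv_lhs => rw [Finset.sum_comm]
    rw [← Finset.sum_neg_distrib]
    refine Finset.sum_congr rfl fun i _ => ?_
    rw [← Finset.sum_neg_distrib]
    refine Finset.sum_congr rfl fun k _ => ?_
    have e : eps k j i = -eps i j k := by
      rw [eps_swap_left j k i, eps_swap_right j i k, eps_swap_left i j k, neg_neg]
    rw [e]
    push_cast
    ring
  rw [h]
  linarith

/-- The three-form `ω̃(u, v, w) = ⟪u × v, w⟫` on `ℝ⁷`. -/
noncomputable def omegaTilde (u v w : E7) : ℝ := ⟪cross u v, w⟫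

/-- The six-sphere: the unit sphere of `ℝ⁷`, with Mathlib's smooth structure. -/
abbrev S6 : Type := Metric.sphere (0 : E7) 1

/-- The tangent space `T_p 𝕊⁶`. -/
abbrev TS (p : S6) : Type := TangentSpace (𝓡 6) p

/-- The differential at `p` of the inclusion of `𝕊⁶` in `ℝ⁷`. -/
noncomputable def dj (p : S6) : TS p →ₗ[ℝ] E7 :=
  (mvfderiv (𝓡 6) (fun q : S6 => (q : E7)) p).toLinearMap

theorem dj_injective (p : S6) : Function.Injective (dj p) :=
  haveI := Fact.mk (@finrank_euclideanSpace_fin ℝ _ (6 + 1))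
  injective_mvfderiv_subtypeVal_sphere (n := 6) p

theorem range_dj (p : S6) : LinearMap.range (dj p) = (Submodule.span ℝ {(p : E7)})ᗮ :=
  haveI := Fact.mk (@finrank_euclideanSpace_fin ℝ _ (6 + 1))
  range_mvfderiv_subtypeVal (n := 6) p

theorem cross_mem_range (p : S6) (v : E7) : crossL (p : E7) v ∈ LinearMap.range (dj p) := by
  rw [range_dj, Submodule.mem_orthogonal_singleton_iff_inner_right]
  exact inner_self_cross _ _

/-- The almost complex structure `J_p u = p × u` on `T_p 𝕊⁶`, identified with `p^⊥ ⊆ ℝ⁷`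
through the differential of the inclusion (see `dj_J`). -/
noncomputable def J (p : S6) : TS p →ₗ[ℝ] TS p :=
  (LinearEquiv.ofInjective (dj p) (dj_injective p)).symm.toLinearMap ∘ₗ
    (((crossL (p : E7)) ∘ₗ dj p).codRestrict (LinearMap.range (dj p))
      (fun u => cross_mem_range p (dj p u)))

theorem dj_J (p : S6) (u : TS p) : dj p (J p u) = cross (p : E7) (dj p u) := by
  have h := (LinearEquiv.ofInjective (dj p) (dj_injective p)).apply_symm_apply
    (((crossL (p : E7)) ∘ₗ dj p).codRestrict (LinearMap.range (dj p))
      (fun u => cross_mem_range p (dj p u)) u)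
  exact congrArg Subtype.val h

/-- The round metric on `𝕊⁶`, induced by the scalar product of `ℝ⁷`. -/
noncomputable def g (p : S6) (u v : TS p) : ℝ := ⟪dj p u, dj p v⟫

/-- The three-form `ω = j^* ω̃` on `𝕊⁶`, where `j` is the inclusion. -/
noncomputable def omega (p : S6) (u v w : TS p) : ℝ :=
  omegaTilde (dj p u) (dj p v) (dj p w)

/-- The Nijenhuis tensor of a field `L` of endomorphisms of the tangent spaces of `𝕊⁶`
with `L² = -1`, on vector fields:
`N_L(X, Y) = [LX, LY] - L[LX, Y] - L[X, LY] - [X, Y]`. -/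
noncomputable def nijenhuis (L : (p : S6) → TS p →ₗ[ℝ] TS p) (X Y : (p : S6) → TS p)
    (p : S6) : TS p :=
  VectorField.mlieBracket (𝓡 6) (fun q => L q (X q)) (fun q => L q (Y q)) p
    - L p (VectorField.mlieBracket (𝓡 6) (fun q => L q (X q)) Y p)
    - L p (VectorField.mlieBracket (𝓡 6) X (fun q => L q (Y q)) p)
    - VectorField.mlieBracket (𝓡 6) X Y p

/-- Smooth vector fields on `𝕊⁶`. -/
def IsSmoothVectorField (X : (p : S6) → TS p) : Prop :=
  ContMDiff (𝓡 6) ((𝓡 6).tangent) ∞ (fun p : S6 => (⟨p, X p⟩ : TangentBundle (𝓡 6) S6))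

end SixSphere

/-! ### Algebra of the seven-dimensional cross product. -/

namespace SixSphere

/-! Everything reduces to the identity N_J(X, Y) = -4 p × (X × Y) in ℝ⁷ (`dj_nijenhuis_J`). Regard
fields as ℝ⁷-valued functions in a chart, with D the flat derivative. Symmetry of the second
derivative of the inclusion gives [V, W] = D_V W - D_W V (`dj_mlieBracket`), and the Leibniz rule
gives D_W(JV) = W × V + p × D_W V (`fderiv_ambientField_J`). In N_J the derivative terms cancel
because J² = -1. What remains is a sum of double cross products, each reduced to ± p × (X × Y) by
the polarized double cross product identity; the multiples of p cancel. Pairing with p × Z gives the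
formula, since p × · is skew and squares to -1 on p^⊥. The algebraic identities are polynomial
identities in the coordinates. -/

theorem cross_eq_toLp (u v : E7) : cross u v = !₂[
    u 1 * v 2 - u 2 * v 1 + (u 3 * v 4 - u 4 * v 3) + (u 5 * v 6 - u 6 * v 5),
    u 2 * v 0 - u 0 * v 2 + (u 3 * v 5 - u 5 * v 3) + (u 6 * v 4 - u 4 * v 6),
    u 0 * v 1 - u 1 * v 0 + (u 6 * v 3 - u 3 * v 6) + (u 5 * v 4 - u 4 * v 5),
    u 4 * v 0 - u 0 * v 4 + (u 5 * v 1 - u 1 * v 5) + (u 2 * v 6 - u 6 * v 2),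
    u 0 * v 3 - u 3 * v 0 + (u 1 * v 6 - u 6 * v 1) + (u 2 * v 5 - u 5 * v 2),
    u 6 * v 0 - u 0 * v 6 + (u 1 * v 3 - u 3 * v 1) + (u 4 * v 2 - u 2 * v 4),
    u 0 * v 5 - u 5 * v 0 + (u 4 * v 1 - u 1 * v 4) + (u 3 * v 2 - u 2 * v 3)] := by
  ext k
  rw [cross_apply]
  fin_cases k <;>
    simp [Fin.sum_univ_succ, eps, IsTriple] <;> ring

theorem cross_cross_self (u v : E7) : cross u (cross u v) = ⟪u, v⟫ • u - ⟪u, u⟫ • v := by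
  ext k
  simp only [cross_eq_toLp, PiLp.inner_apply, RCLike.inner_apply, conj_trivial, Fin.sum_univ_seven]
  fin_cases k <;> simp <;> ring

theorem cross_swap (u v : E7) : cross v u = -cross u v := by
  ext k
  simp only [cross_eq_toLp]
  fin_cases k <;> simp <;> ring

theorem inner_cross_left (u v w : E7) : ⟪cross u v, w⟫ = ⟪u, cross v w⟫ := by
  simp only [cross_eq_toLp, PiLp.inner_apply, RCLike.inner_apply, conj_trivial, Fin.sum_univ_seven]
  simp
  ring

theorem cross_add_right (u v v' : E7) : cross u (v + v') = cross u v + cross u v' :=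
  (crossL u).map_add v v'

theorem cross_sub_right (u v v' : E7) : cross u (v - v') = cross u v - cross u v' :=
  (crossL u).map_sub v v'

theorem cross_neg_right (u v : E7) : cross u (-v) = -cross u v :=
  (crossL u).map_neg v

/-- The polarization of `cross_cross_self`. -/
theorem cross_cross_add_cross_cross (u v w : E7) :
    cross (cross u v) w + cross u (cross v w) =
      (2 * ⟪u, w⟫) • v - ⟪v, w⟫ • u - ⟪u, v⟫ • w := by
  ext k
  simp only [cross_eq_toLp, PiLp.inner_apply, RCLike.inner_apply, conj_trivial, Fin.sum_univ_seven]
  fin_cases k <;> simp <;> ring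

end SixSphere

section

open VectorField Set Filter Topology

/-! ### Lie brackets under the differential of a vector-valued map. -/

section LieBracket

variable {E H M F : Type*} [NormedAddCommGroup E] [NormedSpace ℝ E] [TopologicalSpace H]
  {I : ModelWithCorners ℝ E H} [TopologicalSpace M] [ChartedSpace H M]
  [NormedAddCommGroup F] [NormedSpace ℝ F]

theorem fderivWithin_comp_extChartAt_symm [IsManifold I 1 M] {x : M} {y : E}
    (hy : y ∈ (extChartAt I x).target) {f : M → F}
    (hf : MDifferentiableAt I 𝓘(ℝ, F) f ((extChartAt I x).symm y)) (w : E) :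
    fderivWithin ℝ (fun z => f ((extChartAt I x).symm z)) (range I) y w =
      mvfderiv I f ((extChartAt I x).symm y)
        (mfderivWithin 𝓘(ℝ, E) I (extChartAt I x).symm (range I) y w) := by
  have hu : UniqueMDiffWithinAt 𝓘(ℝ, E) (range I) y :=
    (I.uniqueDiffOn _ (extChartAt_target_subset_range x hy)).uniqueMDiffWithinAt
  have h := mfderiv_comp_mfderivWithin (I := 𝓘(ℝ, E)) (I' := I) (I'' := 𝓘(ℝ, F))
    y hf (mdifferentiableWithinAt_extChartAt_symm hy) hu
  rw [mfderivWithin_eq_fderivWithin] at h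
  exact congrArg (fun T : E →L[ℝ] F => T w) h

theorem fderivWithin_comp_extChartAt_symm_mpullbackWithin [IsManifold I 1 M] {x : M} {y : E}
    (hy : y ∈ (extChartAt I x).target) {f : M → F}
    (hf : MDifferentiableAt I 𝓘(ℝ, F) f ((extChartAt I x).symm y))
    (V : (q : M) → TangentSpace I q) :
    fderivWithin ℝ (fun z => f ((extChartAt I x).symm z)) (range I) y
      (mpullbackWithin 𝓘(ℝ, E) I (extChartAt I x).symm V (range I) y) =
      mvfderiv I f ((extChartAt I x).symm y) (V ((extChartAt I x).symm y)) := by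
  refine (fderivWithin_comp_extChartAt_symm hy hf _).trans ?_
  rw [mpullbackWithin_apply]
  exact congrArg _ ((isInvertible_mfderivWithin_extChartAt_symm hy).self_apply_inverse _)

/-- The differential of a map sends the Lie bracket of two vector fields to the commutator of
the derivatives of the map along the fields, computed in a chart. -/
theorem mvfderiv_mlieBracket [IsManifold I 2 M] {x : M} {f : M → F}
    (hf : ContMDiff I 𝓘(ℝ, F) 2 f) {V W : (q : M) → TangentSpace I q}
    (hV : DifferentiableWithinAt ℝ
      (mpullbackWithin 𝓘(ℝ, E) I (extChartAt I x).symm V (range I)) (range I) (extChartAt I x x))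
    (hW : DifferentiableWithinAt ℝ
      (mpullbackWithin 𝓘(ℝ, E) I (extChartAt I x).symm W (range I)) (range I)
      (extChartAt I x x)) :
    mvfderiv I f x (mlieBracket I V W x) =
      fderivWithin ℝ (fun y => mvfderiv I f ((extChartAt I x).symm y)
          (W ((extChartAt I x).symm y))) (range I) (extChartAt I x x)
        (mpullbackWithin 𝓘(ℝ, E) I (extChartAt I x).symm V (range I) (extChartAt I x x)) -
      fderivWithin ℝ (fun y => mvfderiv I f ((extChartAt I x).symm y)
          (V ((extChartAt I x).symm y))) (range I) (extChartAt I x x)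
        (mpullbackWithin 𝓘(ℝ, E) I (extChartAt I x).symm W (range I) (extChartAt I x x)) := by
  have : IsManifold I 1 M := IsManifold.of_le (n := 2) (by norm_num)
  have hy : extChartAt I x x ∈ (extChartAt I x).target := mem_extChartAt_target x
  have hd (q : M) : MDifferentiableAt I 𝓘(ℝ, F) f q := hf.mdifferentiable (by norm_num) q
  have hc : ContDiffWithinAt ℝ 2 (fun z => f ((extChartAt I x).symm z)) (range I)
      (extChartAt I x x) :=
    (hf.contMDiffAt.comp_contMDiffWithinAt _
      (contMDiffWithinAt_extChartAt_symm_range x hy)).contDiffWithinAt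
  -- Symmetry of the second derivative enters here: the second-order terms of f cancel in the
  -- commutator.
  have key := fderivWithin_apply_lieBracket hc (by simp) I.uniqueDiffOn
    (I.range_subset_closure_interior (mem_range_self _)) (mem_range_self _) hW hV
  have ev (U : (q : M) → TangentSpace I q) :
      (fun z => fderivWithin ℝ (fun z => f ((extChartAt I x).symm z)) (range I) z
        (mpullbackWithin 𝓘(ℝ, E) I (extChartAt I x).symm U (range I) z)) =ᶠ[𝓝[range I]
          (extChartAt I x x)] fun z => mvfderiv I f ((extChartAt I x).symm z)
            (U ((extChartAt I x).symm z)) := by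
    filter_upwards [extChartAt_target_mem_nhdsWithin x] with z hz
    exact fderivWithin_comp_extChartAt_symm_mpullbackWithin hz (hd _) U
  rw [(ev V).fderivWithin_eq_of_mem (mem_range_self _),
    (ev W).fderivWithin_eq_of_mem (mem_range_self _),
    fderivWithin_comp_extChartAt_symm hy (hd _)] at key
  rw [← key]
  have hinv : (mfderiv I 𝓘(ℝ, E) (extChartAt I x) x).inverse =
      mfderivWithin 𝓘(ℝ, E) I (extChartAt I x).symm (range I) (extChartAt I x x) := by
    apply ContinuousLinearMap.inverse_eq
    · exact mfderiv_extChartAt_comp_mfderivWithin_extChartAt_symm' (mem_extChartAt_source x)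
    · exact mfderivWithin_extChartAt_symm_comp_mfderiv_extChartAt' (mem_extChartAt_source x)
  rw [← mlieBracketWithin_univ, mlieBracketWithin_apply, hinv, preimage_univ, univ_inter]
  congr 2
  simp

end LieBracket

/-- Near a point where a family of linear maps is injective, preimages of a differentiable
function depend differentiably on the parameter. -/
theorem DifferentiableAt.of_injective_clm_apply {E G : Type*} [NormedAddCommGroup E]
    [NormedSpace ℝ E] [FiniteDimensional ℝ E] [NormedAddCommGroup G] [NormedSpace ℝ G]
    [FiniteDimensional ℝ G] {P : Type*} [NormedAddCommGroup P] [NormedSpace ℝ P]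
    {A : P → E →L[ℝ] G} {v : P → E} {h : P → G} {y : P}
    (hA : DifferentiableAt ℝ A y) (hinj : Function.Injective (A y))
    (hh : DifferentiableAt ℝ h y) (hv : ∀ᶠ z in 𝓝 y, A z (v z) = h z) :
    DifferentiableAt ℝ v y := by
  have : CompleteSpace E := FiniteDimensional.complete ℝ E
  -- With B a left inverse of A y, the endomorphism B ∘ A z is invertible for z near y, so v = (B ∘
  -- A)⁻¹ (B h) there.
  obtain ⟨B, hB⟩ := (A y : E →ₗ[ℝ] G).exists_leftInverse_of_injective
    (LinearMap.ker_eq_bot.2 hinj)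
  let B' : G →L[ℝ] E := LinearMap.toContinuousLinearMap B
  have hC : DifferentiableAt ℝ (fun z => B'.comp (A z)) y := by fun_prop
  have h1 : B'.comp (A y) = 1 := by
    ext w
    exact LinearMap.congr_fun hB w
  have hU : IsUnit (B'.comp (A y)) := h1 ▸ isUnit_one
  have hi : DifferentiableAt ℝ (fun z => Ring.inverse (B'.comp (A z))) y := by
    obtain ⟨u, hu⟩ := hU
    have h2 : DifferentiableAt ℝ (Ring.inverse : (E →L[ℝ] E) → _) (B'.comp (A y)) :=
      hu ▸ (hasFDerivAt_ringInverse (𝕜 := ℝ) u).differentiableAt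
    exact h2.comp y hC
  have hn : ∀ᶠ z in 𝓝 y, IsUnit (B'.comp (A z)) :=
    hC.continuousAt (Units.isOpen.mem_nhds hU)
  refine (hi.clm_apply (B'.differentiableAt.comp y hh)).congr_of_eventuallyEq ?_
  filter_upwards [hv, hn] with z hz hz'
  have := congrArg (fun T : E →L[ℝ] E => T (v z)) (Ring.inverse_mul_cancel _ hz')
  simp only [Function.comp_apply, ← hz]
  exact this.symm

/-! ### Vector fields on the sphere as ℝ⁷-valued functions in a chart. -/

namespace SixSphere

/-- The cross product as a continuous bilinear map. -/
noncomputable def crossCLM : E7 →L[ℝ] E7 →L[ℝ] E7 := crossL.toContinuousBilinearMap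

theorem crossCLM_apply (u v : E7) : crossCLM u v = cross u v := rfl

instance : Fact (Module.finrank ℝ E7 = 6 + 1) := ⟨finrank_euclideanSpace_fin⟩

/-- The inclusion of the sphere, read in the chart at `p`. -/
noncomputable def chartIncl (p : S6) (y : EuclideanSpace ℝ (Fin 6)) : E7 :=
  ((extChartAt (𝓡 6) p).symm y : S6)

/-- A vector field on the sphere, read in the chart at `p`. -/
noncomputable def chartField (p : S6) (V : (q : S6) → TS q) :
    EuclideanSpace ℝ (Fin 6) → EuclideanSpace ℝ (Fin 6) :=
  mpullbackWithin 𝓘(ℝ, EuclideanSpace ℝ (Fin 6)) (𝓡 6) (extChartAt (𝓡 6) p).symm V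
    (range (𝓡 6))

/-- The `ℝ⁷`-valued function given by a vector field on the sphere, read in the chart at `p`. -/
noncomputable def ambientField (p : S6) (V : (q : S6) → TS q)
    (y : EuclideanSpace ℝ (Fin 6)) : E7 :=
  dj ((extChartAt (𝓡 6) p).symm y) (V ((extChartAt (𝓡 6) p).symm y))

theorem chartIncl_base (p : S6) : chartIncl p (extChartAt (𝓡 6) p p) = p := by
  rw [chartIncl, extChartAt_to_inv]

theorem ambientField_base (p : S6) (V : (q : S6) → TS q) :
    ambientField p V (extChartAt (𝓡 6) p p) = dj p (V p) := by
  rw [ambientField, extChartAt_to_inv]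

theorem contDiffAt_chartIncl (p : S6) : ContDiffAt ℝ ∞ (chartIncl p) (extChartAt (𝓡 6) p p) := by
  have h := ((contMDiff_coe_sphere (E := E7) (n := 6) (m := ∞)).contMDiffAt.comp_contMDiffWithinAt _
      (contMDiffWithinAt_extChartAt_symm_range p (mem_extChartAt_target p))).contDiffWithinAt
  rwa [(𝓡 6).range_eq_univ, contDiffWithinAt_univ] at h

theorem fderiv_chartIncl_chartField {p : S6} {y : EuclideanSpace ℝ (Fin 6)}
    (hy : y ∈ (extChartAt (𝓡 6) p).target) (V : (q : S6) → TS q) :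
    fderiv ℝ (chartIncl p) y (chartField p V y) = ambientField p V y := by
  have h := fderivWithin_comp_extChartAt_symm_mpullbackWithin hy
    ((contMDiff_coe_sphere (E := E7) (n := 6) (m := 1)).mdifferentiable one_ne_zero _) V
  rw [(𝓡 6).range_eq_univ, fderivWithin_univ] at h
  unfold chartField
  rw [(𝓡 6).range_eq_univ]
  exact h

theorem fderiv_chartIncl_base (p : S6) (V : (q : S6) → TS q) :
    fderiv ℝ (chartIncl p) (extChartAt (𝓡 6) p p) (chartField p V (extChartAt (𝓡 6) p p)) =
      dj p (V p) := by
  rw [fderiv_chartIncl_chartField (mem_extChartAt_target p), ambientField_base]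

theorem fderiv_chartIncl_injective (p : S6) :
    Function.Injective (fderiv ℝ (chartIncl p) (extChartAt (𝓡 6) p p)) := by
  have hy := mem_extChartAt_target (I := 𝓡 6) p
  have h (w : EuclideanSpace ℝ (Fin 6)) := fderivWithin_comp_extChartAt_symm hy
    ((contMDiff_coe_sphere (E := E7) (n := 6) (m := 1)).mdifferentiable one_ne_zero _) w
  rw [(𝓡 6).range_eq_univ, fderivWithin_univ] at h
  intro v w hvw
  have hi := isInvertible_mfderivWithin_extChartAt_symm hy
  rw [(𝓡 6).range_eq_univ] at hi
  exact hi.injective (dj_injective _ (((h v).symm.trans hvw).trans (h w)))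

theorem eventually_fderiv_chartIncl_chartField (p : S6) (V : (q : S6) → TS q) :
    ∀ᶠ y in 𝓝 (extChartAt (𝓡 6) p p),
      fderiv ℝ (chartIncl p) y (chartField p V y) = ambientField p V y := by
  filter_upwards [extChartAt_target_mem_nhds (I := 𝓡 6) p] with y hy
  exact fderiv_chartIncl_chartField hy V

theorem differentiableAt_fderiv_chartIncl (p : S6) :
    DifferentiableAt ℝ (fderiv ℝ (chartIncl p)) (extChartAt (𝓡 6) p p) :=
  ((contDiffAt_chartIncl p).fderiv_right (m := 1) (by norm_cast)).differentiableAt one_ne_zero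

theorem IsSmoothVectorField.differentiableAt_chartField {V : (q : S6) → TS q}
    (hV : IsSmoothVectorField V) (p : S6) :
    DifferentiableAt ℝ (chartField p V) (extChartAt (𝓡 6) p p) := by
  have h := MDifferentiableWithinAt.differentiableWithinAt_mpullbackWithin_vectorField
    (s := univ) (hV.mdifferentiable (by simp) p).mdifferentiableWithinAt
  rw [preimage_univ, univ_inter] at h
  exact h.differentiableAt (by simp)

theorem differentiableAt_ambientField {V : (q : S6) → TS q} {p : S6}
    (hV : DifferentiableAt ℝ (chartField p V) (extChartAt (𝓡 6) p p)) :
    DifferentiableAt ℝ (ambientField p V) (extChartAt (𝓡 6) p p) :=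
  ((differentiableAt_fderiv_chartIncl p).clm_apply hV).congr_of_eventuallyEq <|
    (eventually_fderiv_chartIncl_chartField p V).mono fun _ h => h.symm

theorem ambientField_J (p : S6) (V : (q : S6) → TS q) :
    ambientField p (fun q => J q (V q)) = fun y => crossCLM (chartIncl p y) (ambientField p V y) :=
  funext fun _ => dj_J _ _

theorem differentiableAt_ambientField_J {V : (q : S6) → TS q} {p : S6}
    (hV : DifferentiableAt ℝ (chartField p V) (extChartAt (𝓡 6) p p)) :
    DifferentiableAt ℝ (ambientField p (fun q => J q (V q))) (extChartAt (𝓡 6) p p) := by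
  have h1 := (contDiffAt_chartIncl p).differentiableAt (by simp)
  have h2 := differentiableAt_ambientField hV
  rw [ambientField_J]
  fun_prop

/-- The ℝ⁷-valued form of JV is visibly differentiable, and the inclusion is an immersion, so this
descends to the chart. It makes the bracket formula available for JX and JY. -/
theorem differentiableAt_chartField_J {V : (q : S6) → TS q} {p : S6}
    (hV : DifferentiableAt ℝ (chartField p V) (extChartAt (𝓡 6) p p)) :
    DifferentiableAt ℝ (chartField p (fun q => J q (V q))) (extChartAt (𝓡 6) p p) :=
  .of_injective_clm_apply (differentiableAt_fderiv_chartIncl p) (fderiv_chartIncl_injective p)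
    (differentiableAt_ambientField_J hV) (eventually_fderiv_chartIncl_chartField p _)

theorem fderiv_ambientField_J {V : (q : S6) → TS q} {p : S6}
    (hV : DifferentiableAt ℝ (chartField p V) (extChartAt (𝓡 6) p p))
    (W : (q : S6) → TS q) :
    fderiv ℝ (ambientField p (fun q => J q (V q))) (extChartAt (𝓡 6) p p)
        (chartField p W (extChartAt (𝓡 6) p p)) =
      cross (dj p (W p)) (dj p (V p)) + cross p (fderiv ℝ (ambientField p V) (extChartAt (𝓡 6) p p)
        (chartField p W (extChartAt (𝓡 6) p p))) := by
  have h1 := (contDiffAt_chartIncl p).differentiableAt (by simp)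
  have h2 := differentiableAt_ambientField hV
  have h := crossCLM.hasFDerivAt_of_bilinear h1.hasFDerivAt h2.hasFDerivAt
  rw [ambientField_J, h.fderiv]
  simp only [add_apply, ContinuousLinearMap.precompR_apply,
    ContinuousLinearMap.precompL_apply, crossCLM_apply, fderiv_chartIncl_base, chartIncl_base,
    ambientField_base]
  rw [add_comm]
  rfl

theorem dj_mlieBracket {V W : (q : S6) → TS q} {p : S6}
    (hV : DifferentiableAt ℝ (chartField p V) (extChartAt (𝓡 6) p p))
    (hW : DifferentiableAt ℝ (chartField p W) (extChartAt (𝓡 6) p p)) :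
    dj p (mlieBracket (𝓡 6) V W p) =
      fderiv ℝ (ambientField p W) (extChartAt (𝓡 6) p p)
          (chartField p V (extChartAt (𝓡 6) p p)) -
        fderiv ℝ (ambientField p V) (extChartAt (𝓡 6) p p)
          (chartField p W (extChartAt (𝓡 6) p p)) := by
  have h := mvfderiv_mlieBracket (contMDiff_coe_sphere (E := E7) (n := 6) (m := 2))
    hV.differentiableWithinAt hW.differentiableWithinAt
  simp only [(𝓡 6).range_eq_univ, fderivWithin_univ] at h
  unfold chartField
  rw [(𝓡 6).range_eq_univ]
  exact h

/-! ### Evaluation of the Nijenhuis tensor. -/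

theorem inner_dj (p : S6) (v : TS p) : ⟪(p : E7), dj p v⟫ = 0 := by
  rw [← Submodule.mem_orthogonal_singleton_iff_inner_right, ← range_dj]
  exact LinearMap.mem_range_self _ _

theorem inner_self_eq_one (p : S6) : ⟪(p : E7), (p : E7)⟫ = 1 := by
  rw [real_inner_self_eq_norm_sq, norm_eq_of_mem_sphere, one_pow]

theorem cross_cross_dj (p : S6) (v : TS p) : cross p (cross p (dj p v)) = -dj p v := by
  rw [cross_cross_self, inner_dj, inner_self_eq_one, zero_smul, one_smul, zero_sub]

theorem cross_cross_of_inner_eq_zero {u v w : E7} (hv : ⟪u, v⟫ = 0) (hw : ⟪u, w⟫ = 0) :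
    cross (cross u v) w = -cross u (cross v w) - ⟪v, w⟫ • u := by
  have h := cross_cross_add_cross_cross u v w
  rw [hv, hw, mul_zero, zero_smul, zero_smul, sub_zero, zero_sub] at h
  rw [eq_sub_of_add_eq h]
  abel

theorem inner_cross_cross_dj (p : S6) (u : E7) (v : TS p) :
    ⟪cross p u, cross p (dj p v)⟫ = ⟪u, dj p v⟫ := by
  rw [cross_swap u p, inner_neg_left, inner_cross_left, cross_cross_dj, inner_neg_right, neg_neg]

theorem dj_nijenhuis_J {X Y : (q : S6) → TS q} (hX : IsSmoothVectorField X)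
    (hY : IsSmoothVectorField Y) (p : S6) :
    dj p (nijenhuis J X Y p) = -(4 : ℝ) • cross p (cross (dj p (X p)) (dj p (Y p))) := by
  have dX := hX.differentiableAt_chartField p
  have dY := hY.differentiableAt_chartField p
  have dJX := differentiableAt_chartField_J dX
  have dJY := differentiableAt_chartField_J dY
  -- D_X Y and D_Y X need not be tangent separately, so J² = -1 is applied to their difference, the
  -- bracket.
  have hb := cross_cross_dj p (mlieBracket (𝓡 6) X Y p)
  rw [nijenhuis]
  simp only [map_sub, dj_J, dj_mlieBracket, dX, dY, dJX, dJY, fderiv_ambientField_J] at hb ⊢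
  simp only [cross_add_right, cross_sub_right] at hb ⊢
  rw [cross_cross_of_inner_eq_zero (inner_dj _ _) (inner_dj _ _),
    cross_cross_of_inner_eq_zero (inner_dj _ _) (inner_dj _ _),
    cross_swap (dj p (X p)) (dj p (Y p)), cross_neg_right,
    real_inner_comm (dj p (X p)) (dj p (Y p))]
  rw [← sub_eq_zero, ← neg_eq_zero] at hb
  rw [← sub_eq_zero]
  refine .trans ?_ hb
  module

end SixSphere

end

theorem mainTheorem3 (X Y Z : (p : SixSphere.S6) → SixSphere.TS p)
    (hX : SixSphere.IsSmoothVectorField X) (hY : SixSphere.IsSmoothVectorField Y)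
    (hZ : SixSphere.IsSmoothVectorField Z) (p : SixSphere.S6) :
    SixSphere.omega p (X p) (Y p) (Z p) =
      -(1 / 4) * SixSphere.g p (SixSphere.nijenhuis SixSphere.J X Y p)
        (SixSphere.J p (Z p)) := by
  rw [SixSphere.omega, SixSphere.omegaTilde, SixSphere.g, SixSphere.dj_nijenhuis_J hX hY,
    SixSphere.dj_J, inner_smul_left, SixSphere.inner_cross_cross_dj, conj_trivial]
  ring
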